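/- Let $V=V_{\rm Abel}=\langle \partial_x,\,x\partial_x,\,x^2\partial_x,\,x^3\partial_x\rangle$ and $W=W_{\rm Abel}=\langle \partial_x,\,x\partial_x\rangle$, spaces of vector fields on $\mathbb{R}$. Let $\mathcal V$ be the set of smooth $t$-dependent vector fields $X$ on $\mathbb R$ with $X_t\in V$ for every $t\in\mathbb R$ (the Abel equations $\dot x=f_0(t)+f_1(t)x+f_2(t)x^2+f_3(t)x^3$). Let $\mathcal G_W$ be the group of generalised flows $g=(g_t)_{t\in\mathbb R}$, $g_0=\mathrm{id}$, of smooth $t$-dependent vector fields with values in $W$. It acts on $\mathcal V$ by $(g_\bigstar X)_t=\frac{\partial g_t}{\partial t}\circ g_t^{-1}+g_{t*}X_t$. A quasi-Lie invariant is a map $F:\mathcal V\to C^\infty(\mathbb R)$ with $F(g_\bigstar X)=F(X)$ for all $g\in\mathcal G_W$ and $X\in\mathcal V$. It is a smooth quasi-Lie invariant of order $p$ if in addition there is a smooth function $\varphi_F$, defined on the whole of $T^pV\simeq V^{p+1}$, such that $F(X)(t)=\varphi_F\big(X_t,\frac{dX_t}{dt},\dots,\frac{d^pX_t}{dt^p}\big)$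 for all $X\in\mathcal V$ and $t\in\mathbb R$. Abel equations do not admit smooth non-constant quasi-Lie invariants of orders zero and one. More precisely: 1. Let $\varphi:V\to\mathbb R$ be smooth. Then $X\mapsto \varphi(X_t)$ is a quasi-Lie invariant if and only if $\varphi$ is a common first integral of the vector fields $X_0\mapsto -[L,X_0]$ and $X_0\mapsto L$ on $V$, for all $L\in W$. 2. Let $\varphi:TV\simeq V^2\to\mathbb R$ be smooth. Then $X\mapsto\varphi(X_t,\frac{dX_t}{dt})$ is a quasi-Lie invariant if and only if $\varphi$ is a common first integral of the vector fields $(X_0,X_1)\mapsto(-[L,X_0],-[L,X_1])$, $(X_0,X_1)\mapsto(0,L)$ and $(X_0,X_1)\mapsto(L,-[L,X_0])$ on $TV$, for all $L\in W$. 3. For $p\in\{0,1\}$, the smooth quasi-Lie invariants of order $p$ are exactly the constants: $F$ is one if and only if there is $c\in\mathbb R$ with $F(X)(t)=c$ for all $X\in\mathcal V$ and $t\in\mathbb R$. -/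

import Mathlib

open scoped ContDiff

noncomputable section

namespace QuasiLie

section General

variable {E : Type*} [NormedAddCommGroup E] [NormedSpace ℝ E]

/-- A quasi-Lie scheme `S(W,V)`: finite-dimensional spaces of smooth vector fields on `E` (a vector
field is written as a map `E → E`) with `W ⊆ V`, `[W,W] ⊆ W` and `[W,V] ⊆ V`. -/
structure IsQuasiLieScheme (W V : Submodule ℝ (E → E)) : Prop where
  finite_W : FiniteDimensional ℝ W
  finite_V : FiniteDimensional ℝ V
  smooth : ∀ X ∈ V, ContDiff ℝ ∞ X
  le : W ≤ V
  bracket_W : ∀ L ∈ W, ∀ M ∈ W, VectorField.lieBracket ℝ L M ∈ W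
  bracket_V : ∀ L ∈ W, ∀ X ∈ V, VectorField.lieBracket ℝ L X ∈ V

/-- The quasi-Lie family of `V`: smooth `t`-dependent vector fields taking values in `V`. -/
def QuasiLieFamily (V : Submodule ℝ (E → E)) : Type _ :=
  {X : ℝ → E → E // ContDiff ℝ ∞ (Function.uncurry X) ∧ ∀ t, X t ∈ V}

/-- `g` is the generalised flow of the `t`-dependent vector field `Y`: `g_0 = id` and
`t ↦ g_t(x)` solves `dx/dt = Y(t,x)` for every `x`. -/
def IsGeneralisedFlow (Y : ℝ → E → E) (g : ℝ → E ≃ E) : Prop :=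
  g 0 = Equiv.refl E ∧ ∀ t x, HasDerivAt (fun s => g s x) (Y t (g t x)) t

/-- The group of the scheme: all generalised flows of `t`-dependent vector fields with values
in `W`. -/
def schemeGroup (W : Submodule ℝ (E → E)) : Set (ℝ → E ≃ E) :=
  {g | ∃ Y : QuasiLieFamily W, IsGeneralisedFlow Y.1 g}

/-- The transformed `t`-dependent vector field
`(g_⋆ X)_t = (∂g_t/∂t) ∘ g_t⁻¹ + (g_t)_* X_t`. -/
def star (g : ℝ → E ≃ E) (X : ℝ → E → E) : ℝ → E → E := fun t x =>
  deriv (fun s => g s ((g t).symm x)) t +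
    fderiv ℝ (g t) ((g t).symm x) (X t ((g t).symm x))

/-- A quasi-Lie invariant: a map from the quasi-Lie family of `V` to `C^∞(ℝ)` that is invariant
under the action of the group of the scheme. -/
structure IsQuasiLieInvariant (W V : Submodule ℝ (E → E)) (F : QuasiLieFamily V → ℝ → ℝ) :
    Prop where
  smooth : ∀ X, ContDiff ℝ ∞ (F X)
  invariant : ∀ g ∈ schemeGroup W, ∀ X X' : QuasiLieFamily V, X'.1 = star g X.1 → F X' = F X

/-- The space `T^p V`, identified with `V^{p+1}` by `t^p_t X ↦ (X_t, dX_t/dt, …, d^pX_t/dt^p)`. -/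
abbrev JetSpace (p : ℕ) (V : Submodule ℝ (E → E)) : Type _ := Fin (p + 1) → V

theorem iteratedDeriv_mem (V : Submodule ℝ (E → E)) [FiniteDimensional ℝ V]
    (X : QuasiLieFamily V) (i : ℕ) (t : ℝ) :
    (fun x => iteratedDeriv i (fun s => X.1 s x) t) ∈ V := by
  have hc : IsClosed (V : Set (E → E)) := Submodule.closed_of_finiteDimensional V
  have hX : ∀ x, ContDiff ℝ ∞ (fun s => X.1 s x) := fun x =>
    X.2.1.comp (contDiff_id.prodMk contDiff_const)
  induction i generalizing t with
  | zero => simpa using X.2.2 t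
  | succ i ih =>
    have key : Filter.Tendsto
        (fun s : ℝ => (s - t)⁻¹ • ((fun x => iteratedDeriv i (fun r => X.1 r x) s) -
          (fun x => iteratedDeriv i (fun r => X.1 r x) t)))
        (nhdsWithin t {t}ᶜ) (nhds (fun x => iteratedDeriv (i + 1) (fun r => X.1 r x) t)) := by
      rw [tendsto_pi_nhds]
      intro x
      have hd : DifferentiableAt ℝ (iteratedDeriv i (fun r => X.1 r x)) t :=
        ((hX x).differentiable_iteratedDeriv i (by exact_mod_cast WithTop.coe_lt_top _)) t
      have h := hd.hasDerivAt.tendsto_slope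
      rw [iteratedDeriv_succ]
      exact h
    exact hc.mem_of_tendsto key (Filter.Eventually.of_forall fun s =>
      V.smul_mem _ (V.sub_mem (ih s) (ih t)))

/-- The `p`-order tangent vector `t^p_t X` at `t` of the curve `t ↦ X_t` in `V`. -/
def jet (p : ℕ) {V : Submodule ℝ (E → E)} [FiniteDimensional ℝ V] (X : QuasiLieFamily V) (t : ℝ) :
    JetSpace p V :=
  fun i => ⟨fun x => iteratedDeriv i (fun s => X.1 s x) t, iteratedDeriv_mem V X i t⟩

/-- Smoothness of a function on the (finite-dimensional) vector space `T^p V`: it is smooth in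
linear coordinates, i.e. after composition with any linear map from some `ℝ^n`. -/
def IsSmooth {p : ℕ} {V : Submodule ℝ (E → E)} (φ : JetSpace p V → ℝ) : Prop :=
  ∀ (n : ℕ) (e : (Fin n → ℝ) →ₗ[ℝ] JetSpace p V), ContDiff ℝ ∞ (fun y => φ (e y))

/-- The map `X ↦ (t ↦ φ(t^p_t X))` defined by a function `φ` on `T^p V`. -/
def ofJet {p : ℕ} {V : Submodule ℝ (E → E)} [FiniteDimensional ℝ V] (φ : JetSpace p V → ℝ) :
    QuasiLieFamily V → ℝ → ℝ :=
  fun X t => φ (jet p X t)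

/-- A smooth quasi-Lie invariant of order `p`. -/
def IsSmoothInvariantOfOrder (p : ℕ) (W V : Submodule ℝ (E → E)) [FiniteDimensional ℝ V]
    (F : QuasiLieFamily V → ℝ → ℝ) : Prop :=
  IsQuasiLieInvariant W V F ∧ ∃ φ : JetSpace p V → ℝ, IsSmooth φ ∧ F = ofJet φ

/-- `φ` is a first integral of the vector field `Z` on `T^p V`. -/
def IsFirstIntegral {p : ℕ} {V : Submodule ℝ (E → E)} (φ : JetSpace p V → ℝ)
    (Z : JetSpace p V → JetSpace p V) : Prop :=
  ∀ v, HasDerivAt (fun s : ℝ => φ (v + s • Z v)) 0 0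

variable {W V : Submodule ℝ (E → E)}

/-- The Lie bracket `[L, X] ∈ V` of `L ∈ W` and `X ∈ V`. -/
def bracket (h : IsQuasiLieScheme W V) (L : W) (X : V) : V :=
  ⟨VectorField.lieBracket ℝ (L : E → E) (X : E → E), h.bracket_V L L.2 X X.2⟩

/-- The inclusion of `W` in `V`. -/
def incl (h : IsQuasiLieScheme W V) (L : W) : V := ⟨L, h.le L.2⟩

/-- The fundamental vector field, associated with `L ∈ W`, of the action
`(g; (X_0, …, X_p)) ↦ (g_* X_0, …, g_* X_p)`; recall that `d/ds (g_s)_* X = -[L, X]` at `s = 0`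
for the flow `g_s` of `L`. -/
def fieldJ (p : ℕ) (h : IsQuasiLieScheme W V) (L : W) : JetSpace p V → JetSpace p V :=
  fun v i => -bracket h L (v i)

/-- The fundamental vector field, associated with `Y ∈ W`, of the action
`(Y; (X_0, …, X_p)) ↦ (X_0, …, X_{p-1}, X_p + Y)`. -/
def fieldT (p : ℕ) (h : IsQuasiLieScheme W V) (Y : W) : JetSpace p V → JetSpace p V :=
  fun _ => Pi.single (Fin.last p) (incl h Y)

/-- The vector field on `TV` of the flow `(s; (X, Y)) ↦ (X + sZ, Y - [sZ, X])`, for `Z ∈ W`. -/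
def fieldZ (h : IsQuasiLieScheme W V) (Z : W) : JetSpace 1 V → JetSpace 1 V :=
  fun v => ![incl h Z, -bracket h Z (v 0)]

end General

/-- `V_Abel = ⟨∂/∂x, x ∂/∂x, x² ∂/∂x, x³ ∂/∂x⟩`. -/
def abelV : Submodule ℝ (ℝ → ℝ) :=
  Submodule.span ℝ (Set.range fun (k : Fin 4) (x : ℝ) => x ^ (k : ℕ))

/-- `W_Abel = ⟨∂/∂x, x ∂/∂x⟩`. -/
def abelW : Submodule ℝ (ℝ → ℝ) :=
  Submodule.span ℝ (Set.range fun (k : Fin 2) (x : ℝ) => x ^ (k : ℕ))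

instance abelV_finite : FiniteDimensional ℝ abelV :=
  FiniteDimensional.span_of_finite ℝ (Set.finite_range _)

instance abelW_finite : FiniteDimensional ℝ abelW :=
  FiniteDimensional.span_of_finite ℝ (Set.finite_range _)

theorem mem_abelV {f : ℝ → ℝ} :
    f ∈ abelV ↔ ∃ a b c d : ℝ, f = fun x => a + b * x + c * x ^ 2 + d * x ^ 3 := by
  rw [abelV, Submodule.mem_span_range_iff_exists_fun]
  constructor
  · rintro ⟨c, rfl⟩
    refine ⟨c 0, c 1, c 2, c 3, ?_⟩
    funext x
    simp [Fin.sum_univ_four]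
  · rintro ⟨a, b, c, d, rfl⟩
    refine ⟨![a, b, c, d], ?_⟩
    funext x
    simp [Fin.sum_univ_four]

theorem mem_abelW {f : ℝ → ℝ} : f ∈ abelW ↔ ∃ a b : ℝ, f = fun x => a + b * x := by
  rw [abelW, Submodule.mem_span_range_iff_exists_fun]
  constructor
  · rintro ⟨c, rfl⟩
    refine ⟨c 0, c 1, ?_⟩
    funext x
    simp
  · rintro ⟨a, b, rfl⟩
    refine ⟨![a, b], ?_⟩
    funext x
    simp

theorem lieBracket_affine_cubic (p q a b c d : ℝ) :
    VectorField.lieBracket ℝ (fun x : ℝ => p + q * x)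
      (fun x => a + b * x + c * x ^ 2 + d * x ^ 3) =
    fun x => (p * b - q * a) + (2 * p * c) * x + (3 * p * d + q * c) * x ^ 2 +
      (2 * q * d) * x ^ 3 := by
  funext x
  have h1 : HasDerivAt (fun x : ℝ => p + q * x) q x := by
    simpa using ((hasDerivAt_id x).const_mul q).const_add p
  have h2 : HasDerivAt (fun x : ℝ => a + b * x + c * x ^ 2 + d * x ^ 3)
      (b + c * (2 * x) + d * (3 * x ^ 2)) x := by
    have e1 := ((hasDerivAt_id x).const_mul b).const_add a
    have e2 := (hasDerivAt_pow 2 x).const_mul c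
    have e3 := (hasDerivAt_pow 3 x).const_mul d
    exact ((e1.add e2).add e3).congr_deriv (by simp)
  simp only [VectorField.lieBracket, h1.hasFDerivAt.fderiv, h2.hasFDerivAt.fderiv,
    ContinuousLinearMap.toSpanSingleton_apply, smul_eq_mul]
  ring

theorem abel_isQuasiLieScheme : IsQuasiLieScheme abelW abelV where
  finite_W := inferInstance
  finite_V := inferInstance
  smooth := by
    intro X hX
    obtain ⟨a, b, c, d, rfl⟩ := mem_abelV.1 hX
    fun_prop
  le := by
    intro f hf
    obtain ⟨a, b, rfl⟩ := mem_abelW.1 hf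
    exact mem_abelV.2 ⟨a, b, 0, 0, by simp⟩
  bracket_W := by
    intro L hL M hM
    obtain ⟨p, q, rfl⟩ := mem_abelW.1 hL
    obtain ⟨a, b, rfl⟩ := mem_abelW.1 hM
    have h := lieBracket_affine_cubic p q a b 0 0
    simp only [zero_mul, add_zero, mul_zero] at h
    rw [h]
    exact mem_abelW.2 ⟨p * b - q * a, 0, by simp⟩
  bracket_V := by
    intro L hL M hM
    obtain ⟨p, q, rfl⟩ := mem_abelW.1 hL
    obtain ⟨a, b, c, d, rfl⟩ := mem_abelV.1 hM
    rw [lieBracket_affine_cubic]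
    exact mem_abelV.2 ⟨_, _, _, _, rfl⟩

end QuasiLie

end

/-! ### Coordinates on the space of cubic vector fields. -/

namespace QuasiLie

/-! Invariance and the first-integral conditions are compared through a third condition: each forces
`φ` to be constant, and constants satisfy both.

In both cases the affine parts of `X_0` and `X_1` can be removed, which leaves a pair in `⟨x² ∂/∂x,
x³ ∂/∂x⟩`. There dilations contract everything to `0`, since `x²` and `x³` scale by `e^{-s}` and
`e^{-2s}`. As `φ` is continuous at `0`, it equals `φ 0` everywhere.

For first integrals (`eq_zero_of_firstIntegral`) the removal follows straight integral curves and
the contraction is the flow of a weighted Euler field. For invariants (`eq_zero_of_invariant`) a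
single affine flow does both at time `1`. Order zero is pulled back to order one along `TV → V`. -/

/-- The cubic vector field `(a + b x + c x² + d x³) ∂/∂x`. -/
def cubic (a b c d : ℝ) : abelV :=
  ⟨fun x => a + b * x + c * x ^ 2 + d * x ^ 3, mem_abelV.2 ⟨a, b, c, d, rfl⟩⟩

/-- The affine vector field `(p + q x) ∂/∂x`. -/
def affine (p q : ℝ) : abelW := ⟨fun x => p + q * x, mem_abelW.2 ⟨p, q, rfl⟩⟩

theorem exists_eq_cubic (X : abelV) : ∃ a b c d, X = cubic a b c d := by
  obtain ⟨a, b, c, d, h⟩ := mem_abelV.1 X.2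
  exact ⟨a, b, c, d, Subtype.ext h⟩

theorem bracket_affine_cubic (p q a b c d : ℝ) :
    bracket abel_isQuasiLieScheme (affine p q) (cubic a b c d) =
      cubic (p * b - q * a) (2 * p * c) (3 * p * d + q * c) (2 * q * d) :=
  Subtype.ext (lieBracket_affine_cubic p q a b c d)

theorem incl_affine (p q : ℝ) :
    incl abel_isQuasiLieScheme (affine p q) = cubic p q 0 0 :=
  Subtype.ext (by funext x; simp [incl, affine, cubic])

theorem cubic_add (a b c d a' b' c' d' : ℝ) :
    cubic a b c d + cubic a' b' c' d' = cubic (a + a') (b + b') (c + c') (d + d') :=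
  Subtype.ext (by
    funext x
    change (a + b * x + c * x ^ 2 + d * x ^ 3) + (a' + b' * x + c' * x ^ 2 + d' * x ^ 3) =
      (a + a') + (b + b') * x + (c + c') * x ^ 2 + (d + d') * x ^ 3
    ring)

theorem smul_cubic (s a b c d : ℝ) :
    s • cubic a b c d = cubic (s * a) (s * b) (s * c) (s * d) :=
  Subtype.ext (by
    funext x
    change s * (a + b * x + c * x ^ 2 + d * x ^ 3) =
      s * a + s * b * x + s * c * x ^ 2 + s * d * x ^ 3
    ring)

theorem neg_cubic (a b c d : ℝ) : -cubic a b c d = cubic (-a) (-b) (-c) (-d) := by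
  rw [← neg_one_smul ℝ, smul_cubic]
  simp

/-- Reduces an equality of 1-jets to eight scalar identities. -/
theorem pair_cubic_congr {a b c d a' b' c' d' x y z w x' y' z' w' : ℝ} (h1 : a = x) (h2 : b = y)
    (h3 : c = z) (h4 : d = w) (h5 : a' = x') (h6 : b' = y') (h7 : c' = z') (h8 : d' = w') :
    (![cubic a b c d, cubic a' b' c' d'] : JetSpace 1 abelV) =
      ![cubic x y z w, cubic x' y' z' w'] := by
  subst_vars
  rfl

/-- Linear coordinates on the pairs of vector fields in `⟨x² ∂/∂x, x³ ∂/∂x⟩`. -/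
def slice : (Fin 4 → ℝ) →ₗ[ℝ] JetSpace 1 abelV where
  toFun y := ![cubic 0 0 (y 0) (y 1), cubic 0 0 (y 2) (y 3)]
  map_add' y z := by
    funext i
    fin_cases i <;> simp [cubic_add]
  map_smul' s y := by
    funext i
    fin_cases i <;> simp [smul_cubic]

theorem slice_apply (y : Fin 4 → ℝ) :
    slice y = ![cubic 0 0 (y 0) (y 1), cubic 0 0 (y 2) (y 3)] := rfl

/-! ### First integrals are constant. -/

section FirstIntegrals

/-- If `Z` is constant along the line through `v` with direction `Z v`, then a first integral of
`Z` takes the same value at `v` and at `v + Z v`. -/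
theorem IsFirstIntegral.eq_of_line {p : ℕ} {V : Submodule ℝ (ℝ → ℝ)} {φ : JetSpace p V → ℝ}
    {Z : JetSpace p V → JetSpace p V} (h : IsFirstIntegral φ Z) (v : JetSpace p V)
    (hZ : ∀ s : ℝ, Z (v + s • Z v) = Z v) : φ (v + Z v) = φ v := by
  have hd : ∀ s : ℝ, HasDerivAt (fun r : ℝ => φ (v + r • Z v)) 0 s := by
    -- The hypothesis only gives the derivative at parameter `0`, so it is applied at the point `v +
    -- s • Z v` and the parameter is then shifted by `s`.
    intro s
    have h1 := h (v + s • Z v)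
    rw [hZ s] at h1
    have h2 : HasDerivAt (fun r : ℝ => r - s) 1 s := (hasDerivAt_id s).sub_const s
    have h3 := HasDerivAt.scomp_of_eq s h1 h2 (by simp)
    refine (h3.congr_deriv (by simp)).congr_of_eventuallyEq (.of_forall fun r => ?_)
    simp only [Function.comp_apply]
    congr 1
    module
  have := is_const_of_deriv_eq_zero (fun s => (hd s).differentiableAt) (fun s => (hd s).deriv) 1 0
  simpa using this

/-- A function annihilated by a weighted Euler field with positive weights is constant. -/
theorem eq_zero_of_weighted_euler {n : ℕ} {ψ : (Fin n → ℝ) → ℝ} (hψ : Differentiable ℝ ψ)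
    (w : Fin n → ℝ) (hw : ∀ i, 0 < w i)
    (h : ∀ y, HasDerivAt (fun s : ℝ => ψ (y + s • fun i => -(w i * y i))) 0 0) (y : Fin n → ℝ) :
    ψ y = ψ 0 := by
  set γ : ℝ → Fin n → ℝ := fun s i => Real.exp (-(w i * s)) * y i with hγ
  -- The curve `γ` is the integral curve of the Euler field from `y`, so `ψ` is constant along it.
  -- Positive weights make it tend to `0`.
  have hfd : ∀ z, fderiv ℝ ψ z (fun i => -(w i * z i)) = 0 := by
    intro z
    have h1 : HasDerivAt (fun s : ℝ => z + s • fun i => -(w i * z i))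
        (fun i => -(w i * z i)) 0 := by
      simpa using ((hasDerivAt_id (0 : ℝ)).smul_const (fun i => -(w i * z i))).const_add z
    have h2 := HasFDerivAt.comp_hasDerivAt_of_eq (0 : ℝ) (hψ z).hasFDerivAt h1 (by simp)
    exact h2.unique (h z)
  have hγd : ∀ s, HasDerivAt γ (fun i => -(w i * γ s i)) s := by
    intro s
    rw [hasDerivAt_pi]
    intro i
    have h1 : HasDerivAt (fun s : ℝ => -(w i * s)) (-w i) s := by
      simpa using ((hasDerivAt_id s).const_mul (w i)).fun_neg
    exact (h1.exp.mul_const (y i)).congr_deriv (by simp only [hγ]; ring)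
  have hd : ∀ s, HasDerivAt (ψ ∘ γ) 0 s := fun s =>
    ((hψ (γ s)).hasFDerivAt.comp_hasDerivAt s (hγd s)).congr_deriv (hfd _)
  have hconst : ∀ s, ψ (γ s) = ψ y := fun s => by
    have := is_const_of_deriv_eq_zero (fun s => (hd s).differentiableAt)
      (fun s => (hd s).deriv) s 0
    simpa [hγ] using this
  have hlim : Filter.Tendsto γ Filter.atTop (nhds 0) := by
    rw [tendsto_pi_nhds]
    intro i
    have h1 : Filter.Tendsto (fun s : ℝ => Real.exp (-(w i * s))) Filter.atTop (nhds 0) :=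
      Real.tendsto_exp_neg_atTop_nhds_zero.comp (Filter.tendsto_id.const_mul_atTop (hw i))
    simpa [hγ] using h1.mul_const (y i)
  have h1 := (hψ.continuous.tendsto 0).comp hlim
  have h2 : ψ ∘ γ = fun _ => ψ y := funext hconst
  rw [h2] at h1
  exact tendsto_nhds_unique tendsto_const_nhds h1

/-- A smooth common first integral of the fundamental fields on `T V_Abel` is constant. -/
theorem eq_zero_of_firstIntegral {φ : JetSpace 1 abelV → ℝ} (hφ : IsSmooth φ)
    (h : ∀ L : abelW, IsFirstIntegral φ (fieldJ 1 abel_isQuasiLieScheme L) ∧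
      IsFirstIntegral φ (fieldT 1 abel_isQuasiLieScheme L) ∧
      IsFirstIntegral φ (fieldZ abel_isQuasiLieScheme L)) (v : JetSpace 1 abelV) :
    φ v = φ 0 := by
  obtain ⟨a, b, c, d, hv⟩ := exists_eq_cubic (v 0)
  -- Here `L` is minus the affine part of `X_0`. The field is constant along the line because `[L,
  -- X_0 + sL] = [L, X_0]`, and time one kills the affine part.
  have h1 := (h (affine (-a) (-b))).2.2.eq_of_line v (by
    intro s
    simp only [fieldZ, Pi.add_apply, Pi.smul_apply, Matrix.cons_val_zero, hv, incl_affine,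
      smul_cubic, cubic_add, bracket_affine_cubic]
    congr 3
    · congr 1 <;> ring)
  set u := v + fieldZ abel_isQuasiLieScheme (affine (-a) (-b)) v with hu
  obtain ⟨a', b', c', d', hu1⟩ := exists_eq_cubic (u 1)
  have hu0 : u 0 = cubic 0 0 c d := by
    rw [hu, Pi.add_apply, hv]
    simp [fieldZ, incl_affine, cubic_add]
  -- This field moves only `X_1`, so the normal form of `X_0` survives while the affine part of
  -- `X_1` is removed.
  have h2 := (h (affine (-a') (-b'))).2.1.eq_of_line u (fun s => rfl)
  have hs : u + fieldT 1 abel_isQuasiLieScheme (affine (-a') (-b')) u =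
      slice ![c, d, c', d'] := by
    funext i
    fin_cases i
    · simp [fieldT, slice_apply, hu0, Fin.last]
    · have : (Fin.last 1) = 1 := rfl
      simp [fieldT, slice_apply, hu1, incl_affine, this, cubic_add]
  rw [hs] at h2
  rw [← h1, ← h2]
  -- The weights come from `[x ∂/∂x, x² ∂/∂x] = x² ∂/∂x` and `[x ∂/∂x, x³ ∂/∂x] = 2x³ ∂/∂x`.
  have h3 := eq_zero_of_weighted_euler (ψ := fun y => φ (slice y))
    ((hφ 4 slice).differentiable (by simp)) ![1, 2, 1, 2]
    (by intro i; fin_cases i <;> norm_num) (by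
      intro y
      have hJ := (h (affine 0 1)).1 (slice y)
      have he : fieldJ 1 abel_isQuasiLieScheme (affine 0 1) (slice y) =
          slice (fun i => -((![1, 2, 1, 2] : Fin 4 → ℝ) i * y i)) := by
        funext i
        fin_cases i <;>
          simp [fieldJ, slice_apply, bracket_affine_cubic, neg_cubic]
      rw [he] at hJ
      simpa only [map_add, map_smul] using hJ) ![c, d, c', d']
  simpa using h3

end FirstIntegrals

/-! ### Invariants are constant. -/

section Invariants

/-- A curve in `V_Abel` given by smooth coefficients. -/
def cubicCurve (a b c d : ℝ → ℝ) (ha : ContDiff ℝ ∞ a) (hb : ContDiff ℝ ∞ b)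
    (hc : ContDiff ℝ ∞ c) (hd : ContDiff ℝ ∞ d) : QuasiLieFamily abelV :=
  ⟨fun t => cubic (a t) (b t) (c t) (d t), by
    refine ⟨?_, fun t => (cubic (a t) (b t) (c t) (d t)).2⟩
    simp only [Function.uncurry_def, cubic]
    fun_prop⟩

theorem jet_cubicCurve {a b c d : ℝ → ℝ} (ha : ContDiff ℝ ∞ a) (hb : ContDiff ℝ ∞ b)
    (hc : ContDiff ℝ ∞ c) (hd : ContDiff ℝ ∞ d) {t a' b' c' d' : ℝ} (ha' : HasDerivAt a a' t)
    (hb' : HasDerivAt b b' t) (hc' : HasDerivAt c c' t) (hd' : HasDerivAt d d' t) :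
    jet 1 (cubicCurve a b c d ha hb hc hd) t =
      ![cubic (a t) (b t) (c t) (d t), cubic a' b' c' d'] := by
  funext i
  fin_cases i
  · exact Subtype.ext (by funext x; simp [jet, cubicCurve])
  · refine Subtype.ext (funext fun x => ?_)
    have h := ((ha'.add (hb'.mul_const x)).add (hc'.mul_const (x ^ 2))).add
      (hd'.mul_const (x ^ 3))
    simp only [jet, Fin.mk_one, iteratedDeriv_one]
    exact h.deriv

/-- The `t`-dependent affine diffeomorphism `x ↦ e^{μ(t)} (x + β(t))`. -/
noncomputable def affineEquiv (μ β : ℝ → ℝ) (t : ℝ) : ℝ ≃ ℝ where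
  toFun x := Real.exp (μ t) * (x + β t)
  invFun x := Real.exp (-μ t) * x - β t
  left_inv x := by
    simp only [← mul_assoc, ← Real.exp_add]
    simp
  right_inv x := by
    simp only [sub_add_cancel, ← mul_assoc, ← Real.exp_add]
    simp

theorem hasDerivAt_affineEquiv {μ β : ℝ → ℝ} {μ' β' t : ℝ} (hμ : HasDerivAt μ μ' t)
    (hβ : HasDerivAt β β' t) (x : ℝ) :
    HasDerivAt (fun s => affineEquiv μ β s x)
      (Real.exp (μ t) * β' + μ' * affineEquiv μ β t x) t :=
  (hμ.exp.mul (hβ.const_add x)).congr_deriv (by simp only [affineEquiv, Equiv.coe_fn_mk]; ring)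

/-- The velocity at the moving point `x` is `e^μ β' + μ' x`, which is affine in `x`. The initial
conditions give `g_0 = id`. -/
theorem affineEquiv_mem_schemeGroup {μ β μ' β' : ℝ → ℝ} (hμ : ∀ t, HasDerivAt μ (μ' t) t)
    (hβ : ∀ t, HasDerivAt β (β' t) t) (sμ : ContDiff ℝ ∞ μ) (sμ' : ContDiff ℝ ∞ μ')
    (sβ' : ContDiff ℝ ∞ β') (μ0 : μ 0 = 0) (β0 : β 0 = 0) :
    affineEquiv μ β ∈ schemeGroup abelW := by
  refine ⟨⟨fun t x => Real.exp (μ t) * β' t + μ' t * x, ?_, fun t => mem_abelW.2 ⟨_, _, rfl⟩⟩,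
    ?_, fun t x => hasDerivAt_affineEquiv (hμ t) (hβ t) x⟩
  · simp only [Function.uncurry_def]
    fun_prop
  · ext x
    simp [affineEquiv, μ0, β0]

theorem star_affineEquiv {μ β μ' β' : ℝ → ℝ} (hμ : ∀ t, HasDerivAt μ (μ' t) t)
    (hβ : ∀ t, HasDerivAt β (β' t) t) (X : ℝ → ℝ → ℝ) (t x : ℝ) :
    star (affineEquiv μ β) X t x = Real.exp (μ t) * β' t + μ' t * x +
      Real.exp (μ t) * X t (Real.exp (-μ t) * x - β t) := by
  have h1 := (hasDerivAt_affineEquiv (hμ t) (hβ t) ((affineEquiv μ β t).symm x)).deriv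
  have h2 : HasDerivAt (affineEquiv μ β t) (Real.exp (μ t)) ((affineEquiv μ β t).symm x) := by
    exact (((hasDerivAt_id ((affineEquiv μ β t).symm x)).add_const (β t)).const_mul
      (Real.exp (μ t))).congr_deriv (mul_one _)
  rw [star, h1, Equiv.apply_symm_apply, h2.hasFDerivAt.fderiv]
  simp only [ContinuousLinearMap.toSpanSingleton_apply, smul_eq_mul]
  rw [mul_comm (X t _)]
  rfl

/-- The curve with coefficients `-β' - μ'β + cβ² + dβ³`, `-μ' + 2cβ + 3dβ²`, `c + 3dβ`, `d` is
mapped by `x ↦ e^μ (x + β)` to the curve with coefficients `0`, `0`, `c e^{-μ}`, `d e^{-2μ}`. -/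
theorem IsQuasiLieInvariant.cubicCurve_eq {F : QuasiLieFamily abelV → ℝ → ℝ}
    (hF : IsQuasiLieInvariant abelW abelV F) {μ β μ' β' c d : ℝ → ℝ}
    (hμ : ∀ t, HasDerivAt μ (μ' t) t) (hβ : ∀ t, HasDerivAt β (β' t) t)
    (sμ : ContDiff ℝ ∞ μ) (sμ' : ContDiff ℝ ∞ μ') (sβ : ContDiff ℝ ∞ β)
    (sβ' : ContDiff ℝ ∞ β') (sc : ContDiff ℝ ∞ c) (sd : ContDiff ℝ ∞ d)
    (μ0 : μ 0 = 0) (β0 : β 0 = 0) :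
    F (cubicCurve (fun _ => 0) (fun _ => 0) (fun t => c t * Real.exp (-μ t))
        (fun t => d t * Real.exp (-μ t) ^ 2) (by fun_prop) (by fun_prop) (by fun_prop)
        (by fun_prop)) =
      F (cubicCurve (fun t => -β' t - μ' t * β t + c t * β t ^ 2 + d t * β t ^ 3)
        (fun t => -μ' t + 2 * c t * β t + 3 * d t * β t ^ 2) (fun t => c t + 3 * d t * β t) d
        (by fun_prop) (by fun_prop) (by fun_prop) sd) := by
  refine hF.invariant _ (affineEquiv_mem_schemeGroup hμ hβ sμ sμ' sβ' μ0 β0) _ _ ?_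
  funext t x
  rw [star_affineEquiv hμ hβ]
  simp only [cubicCurve, cubic, Real.exp_neg]
  field_simp
  ring

/-- There is a smooth function vanishing at `0` with prescribed value, first and second derivative
at `1`. -/
theorem exists_jet_at_one (s m k : ℝ) : ∃ μ μ' μ'' : ℝ → ℝ, (∀ t, HasDerivAt μ (μ' t) t) ∧
    (∀ t, HasDerivAt μ' (μ'' t) t) ∧ ContDiff ℝ ∞ μ ∧ ContDiff ℝ ∞ μ' ∧
    μ 0 = 0 ∧ μ 1 = s ∧ μ' 1 = m ∧ μ'' 1 = k := by
  -- The polynomial `t (A + B t + C t²)` vanishes at `0`; its three coefficients solve the three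
  -- conditions at `1`.
  set A := 3 * s - 2 * m + k / 2 with hA
  set B := -3 * s + 3 * m - k with hB
  set C := s - m + k / 2 with hC
  have hp : ∀ a b c t : ℝ, HasDerivAt (fun t => a + b * t + c * t ^ 2) (b + 2 * c * t) t := by
    intro a b c t
    have e1 := ((hasDerivAt_id t).const_mul b).const_add a
    exact (e1.add ((hasDerivAt_pow 2 t).const_mul c)).congr_deriv (by simp; ring)
  refine ⟨fun t => t * (A + B * t + C * t ^ 2), fun t => A + 2 * B * t + 3 * C * t ^ 2,
    fun t => 2 * B + 2 * (3 * C) * t, fun t => ?_, fun t => hp _ _ _ t, by fun_prop, by fun_prop,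
    by simp, ?_, ?_, ?_⟩
  · exact ((hasDerivAt_id t).mul (hp A B C t)).congr_deriv (by simp; ring)
  all_goals simp only [hA, hB, hC]; ring

/-- A smooth invariant of order one is constant. -/
theorem eq_zero_of_invariant {φ : JetSpace 1 abelV → ℝ} (hφ : IsSmooth φ)
    (hF : IsQuasiLieInvariant abelW abelV (ofJet φ)) (v : JetSpace 1 abelV) : φ v = φ 0 := by
  obtain ⟨a, b, c, d, hv0⟩ := exists_eq_cubic (v 0)
  obtain ⟨a', b', c', d', hv1⟩ := exists_eq_cubic (v 1)
  have hv : v = ![cubic a b c d, cubic a' b' c' d'] := by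
    funext i
    fin_cases i
    · exact hv0
    · exact hv1
  -- The quadratic coefficient of the source curve is `c(t) + 3 d(t) β`. With `β'(1) = -a`, its
  -- derivative at `1` is `c'` exactly when `c(t)` has slope `C`.
  set C := c' + 3 * d * a with hC
  have key : ∀ s : ℝ, φ (slice ![c * Real.exp (-s), d * Real.exp (-s) ^ 2,
      (C + b * c) * Real.exp (-s), (d' + 2 * b * d) * Real.exp (-s) ^ 2]) = φ v := by
    intro s
    -- Time `1` is used because `g_0 = id` would force `μ = 0` at time `0`. The derivatives of `μ`
    -- and `β` are chosen so that the source curve has jet `v` at `1`; the value `μ(1) = s` stays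
    -- free.
    obtain ⟨μ, μ', μ'', hμ, hμ', sμ, sμ', μ0, μ1, μ1', μ1''⟩ :=
      exists_jet_at_one s (-b) (-b' - 2 * c * a)
    obtain ⟨β, β', β'', hβ, hβ', sβ, sβ', β0, β1, β1', β1''⟩ :=
      exists_jet_at_one 0 (-a) (-a' - b * a)
    have hlin : ∀ p q : ℝ, HasDerivAt (fun t => p + q * (t - 1)) q 1 := by
      intro p q
      simpa using (((hasDerivAt_id (1 : ℝ)).sub_const 1).const_mul q).const_add p
    have h := congrFun (hF.cubicCurve_eq (c := fun t => c + C * (t - 1))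
      (d := fun t => d + d' * (t - 1)) hμ hβ sμ sμ' sβ sβ' (by fun_prop) (by fun_prop) μ0 β0) 1
    have hc := hlin c C
    have hd := hlin d d'
    have hE := (hμ 1).fun_neg.exp
    have hb := hβ 1
    rw [ofJet, ofJet,
      jet_cubicCurve _ _ _ _ (hasDerivAt_const _ _) (hasDerivAt_const _ _) (hc.fun_mul hE)
        (hd.fun_mul (hE.fun_pow 2)),
      jet_cubicCurve _ _ _ _
        ((((hβ' 1).fun_neg.fun_sub ((hμ' 1).fun_mul hb)).fun_add (hc.fun_mul (hb.fun_pow 2))).fun_add (hd.fun_mul (hb.fun_pow 3)))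
        (((hμ' 1).fun_neg.fun_add ((hc.const_mul 2).fun_mul hb)).fun_add ((hd.const_mul 3).fun_mul (hb.fun_pow 2)))
        (hc.fun_add ((hd.const_mul 3).fun_mul hb)) hd] at h
    rw [hv]
    refine (congrArg φ ?_).trans (h.trans (congrArg φ ?_))
    -- The terms `b * c` and `2 * b * d` come from differentiating `e^{-μ}` and `e^{-2μ}` with
    -- `μ'(1) = -b`.
    · rw [slice_apply]
      apply pair_cubic_congr <;> simp [μ1, μ1'] <;> ring
    · apply pair_cubic_congr <;> simp [μ1', β1', β1, μ1'', β1'', hC]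
  have hlim : Filter.Tendsto (fun s : ℝ => (![c * Real.exp (-s), d * Real.exp (-s) ^ 2,
      (C + b * c) * Real.exp (-s), (d' + 2 * b * d) * Real.exp (-s) ^ 2] : Fin 4 → ℝ))
      Filter.atTop (nhds 0) := by
    have h1 := Real.tendsto_exp_neg_atTop_nhds_zero
    have h2 := h1.pow 2
    rw [tendsto_pi_nhds]
    intro i
    fin_cases i
    · simpa using h1.const_mul c
    · simpa using h2.const_mul d
    · simpa using h1.const_mul (C + b * c)
    · simpa using h2.const_mul (d' + 2 * b * d)
  -- By `key` the function of `s` is constantly `φ v`, while its limit as `s → ∞` is `φ 0`.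
  have h1 := ((hφ 4 slice).continuous.tendsto 0).comp hlim
  simp only [Function.comp_def, key, map_zero] at h1
  exact tendsto_nhds_unique tendsto_const_nhds h1

end Invariants

/-! ### Constants satisfy every condition; reduction of order zero to order one. -/

section Constants

variable {W V : Submodule ℝ (ℝ → ℝ)}

theorem isQuasiLieInvariant_const (c : ℝ) :
    IsQuasiLieInvariant W V (fun _ _ => c) where
  smooth _ := contDiff_const
  invariant _ _ _ _ _ := rfl

theorem isFirstIntegral_of_eq {p : ℕ} {φ : JetSpace p V → ℝ} {c : ℝ} (h : ∀ v, φ v = c)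
    (Z : JetSpace p V → JetSpace p V) : IsFirstIntegral φ Z := fun v => by
  simpa only [h] using hasDerivAt_const (0 : ℝ) c

theorem isQuasiLieInvariant_ofJet_of_eq [FiniteDimensional ℝ V] {p : ℕ} {φ : JetSpace p V → ℝ}
    {c : ℝ} (h : ∀ v, φ v = c) : IsQuasiLieInvariant W V (ofJet φ) := by
  have : ofJet φ = fun _ _ => c := by
    funext X t
    exact h _
  rw [this]
  exact isQuasiLieInvariant_const c

/-- The projection `T V → V`, in terms of jet spaces. -/
def proj (V : Submodule ℝ (ℝ → ℝ)) : JetSpace 1 V →ₗ[ℝ] JetSpace 0 V where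
  toFun v := fun _ => v 0
  map_add' _ _ := rfl
  map_smul' _ _ := rfl

theorem IsSmooth.comp_proj {φ : JetSpace 0 V → ℝ} (h : IsSmooth φ) :
    IsSmooth (fun v => φ (proj V v)) :=
  fun n e => h n (proj V ∘ₗ e)

theorem ofJet_comp_proj [FiniteDimensional ℝ V] (φ : JetSpace 0 V → ℝ) :
    ofJet (fun v => φ (proj V v)) = ofJet φ := by
  funext X t
  refine congrArg φ (funext fun i => ?_)
  rw [Fin.fin_one_eq_zero i]
  rfl

theorem proj_const (v : JetSpace 0 V) : proj V (fun _ => v 0) = v := by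
  funext i
  rw [Fin.fin_one_eq_zero i]
  rfl

end Constants

theorem eq_zero_of_invariant_zero {φ : JetSpace 0 abelV → ℝ} (hφ : IsSmooth φ)
    (hF : IsQuasiLieInvariant abelW abelV (ofJet φ)) (v : JetSpace 0 abelV) : φ v = φ 0 := by
  rw [← ofJet_comp_proj] at hF
  simpa [proj_const] using eq_zero_of_invariant hφ.comp_proj hF (fun _ => v 0)

/-- Under `TV → V` the fields `fieldJ 1` and `fieldZ` project to `fieldJ 0` and `fieldT 0`, and
`fieldT 1` is vertical. The pullback of `φ` is therefore a first integral of all three. -/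
theorem eq_zero_of_firstIntegral_zero {φ : JetSpace 0 abelV → ℝ} (hφ : IsSmooth φ)
    (h : ∀ L : abelW, IsFirstIntegral φ (fieldJ 0 abel_isQuasiLieScheme L) ∧
      IsFirstIntegral φ (fieldT 0 abel_isQuasiLieScheme L)) (v : JetSpace 0 abelV) :
    φ v = φ 0 := by
  have h1 := eq_zero_of_firstIntegral hφ.comp_proj (fun L => ⟨fun v => ?_, fun v => ?_,
    fun v => ?_⟩) (fun _ => v 0)
  · simpa [proj_const] using h1
  · simp only [map_add, map_smul]
    exact (h L).1 (proj abelV v)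
  · have : proj abelV (fieldT 1 abel_isQuasiLieScheme L v) = 0 := by
      funext i
      simp [proj, fieldT, Fin.last]
    simpa only [map_add, map_smul, this, smul_zero] using hasDerivAt_const _ _
  · have : proj abelV (fieldZ abel_isQuasiLieScheme L v) =
        fieldT 0 abel_isQuasiLieScheme L (proj abelV v) := by
      funext i
      rw [Fin.fin_one_eq_zero i]
      simp [proj, fieldT, fieldZ, Fin.last]
    simp only [map_add, map_smul, this]
    exact (h L).2 (proj abelV v)

end QuasiLie

theorem mainTheorem9 :
    (∀ φ : QuasiLie.JetSpace 0 QuasiLie.abelV → ℝ, QuasiLie.IsSmooth φ →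
      (QuasiLie.IsQuasiLieInvariant QuasiLie.abelW QuasiLie.abelV (QuasiLie.ofJet φ) ↔
        ∀ L : QuasiLie.abelW,
          QuasiLie.IsFirstIntegral φ (QuasiLie.fieldJ 0 QuasiLie.abel_isQuasiLieScheme L) ∧
          QuasiLie.IsFirstIntegral φ (QuasiLie.fieldT 0 QuasiLie.abel_isQuasiLieScheme L))) ∧
    (∀ φ : QuasiLie.JetSpace 1 QuasiLie.abelV → ℝ, QuasiLie.IsSmooth φ →
      (QuasiLie.IsQuasiLieInvariant QuasiLie.abelW QuasiLie.abelV (QuasiLie.ofJet φ) ↔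
        ∀ L : QuasiLie.abelW,
          QuasiLie.IsFirstIntegral φ (QuasiLie.fieldJ 1 QuasiLie.abel_isQuasiLieScheme L) ∧
          QuasiLie.IsFirstIntegral φ (QuasiLie.fieldT 1 QuasiLie.abel_isQuasiLieScheme L) ∧
          QuasiLie.IsFirstIntegral φ (QuasiLie.fieldZ QuasiLie.abel_isQuasiLieScheme L))) ∧
    (∀ p : ℕ, p ≤ 1 → ∀ F : QuasiLie.QuasiLieFamily QuasiLie.abelV → ℝ → ℝ,
      (QuasiLie.IsSmoothInvariantOfOrder p QuasiLie.abelW QuasiLie.abelV F ↔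
        ∃ c : ℝ, F = fun _ _ => c)) := by
  open QuasiLie in
  refine ⟨fun φ hφ => ⟨fun h L => ?_, fun h => ?_⟩, fun φ hφ => ⟨fun h L => ?_, fun h => ?_⟩,
    fun p hp F => ⟨?_, ?_⟩⟩
  · have hc := eq_zero_of_invariant_zero hφ h
    exact ⟨isFirstIntegral_of_eq hc _, isFirstIntegral_of_eq hc _⟩
  · exact isQuasiLieInvariant_ofJet_of_eq (eq_zero_of_firstIntegral_zero hφ h)
  · have hc := eq_zero_of_invariant hφ h
    exact ⟨isFirstIntegral_of_eq hc _, isFirstIntegral_of_eq hc _, isFirstIntegral_of_eq hc _⟩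
  · exact isQuasiLieInvariant_ofJet_of_eq (eq_zero_of_firstIntegral hφ h)
  · rintro ⟨hF, φ, hφ, rfl⟩
    refine ⟨φ 0, ?_⟩
    funext X t
    obtain rfl | rfl : p = 0 ∨ p = 1 := by omega
    · exact eq_zero_of_invariant_zero hφ hF _
    · exact eq_zero_of_invariant hφ hF _
  · rintro ⟨c, rfl⟩
    exact ⟨isQuasiLieInvariant_const c, fun _ => c, fun _ _ => contDiff_const, rfl⟩
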